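/- **Setting.** Let $K\ge 1$ and let $\mathcal P_1,\dots,\mathcal P_K$ be probability distributions on $\mathbb R$ with means $\mu_1,\dots,\mu_K$ that are 1-sub-Gaussian: $\mathbb E_{y\sim\mathcal P_j} e^{\lambda(y-\mu_j)}\le e^{\lambda^2/2}$ for all $\lambda\in\mathbb R$ and $j\in[K]=\{1,\dots,K\}$. Put $\Delta_j=\max_{k\in[K]}\mu_k-\mu_j$. Fix $\sigma>0$. For data $\mathcal D_t=((x_1,\phi_1),\dots,(x_t,\phi_t))\in([K]\times\mathbb R)^t$ and $\theta\in\mathbb R^K$ define the Gaussian likelihood $$\mathcal L(\theta;\mathcal D_t)=\prod_{i=1}^t\frac1{\sqrt{2\pi}\,\sigma}\exp\Big(-\frac{(\theta_{x_i}-\phi_i)^2}{2\sigma^2}\Big),$$ the profile likelihood $\bar{\mathcal L}(j;\mathcal D_t)=\sup\{\mathcal L(\theta;\mathcal D_t):\theta\in\mathbb R^K,\ \theta_j\ge\theta_k\ \forall k\in[K]\}$, and, for the uniform prior $\mathcal Q_0(j)=1/K$, the generalized posterior $$\mathcal Q_t(j)=\frac{\bar{\mathcal L}(j;\mathcal D_t)\,\mathcal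 Q_0(j)}{\sum_{k=1}^K\bar{\mathcal L}(k;\mathcal D_t)\,\mathcal Q_0(k)},\qquad j\in[K].$$ Minimalist Thompson sampling (MINTS) generates $(x_t,\phi_t)_{t\ge1}$ as follows: conditionally on $\mathcal D_{t-1}$, the arm $x_t$ has distribution $\mathcal Q_{t-1}$; conditionally on $\mathcal D_{t-1}$ and $x_t$, the reward $\phi_t$ has distribution $\mathcal P_{x_t}$. Its regret over $T$ rounds is $\mathcal R(T)=\sum_{t=1}^T\big(\max_{j\in[K]}\mu_j-\mu_{x_t}\big)$. **Theorem (Regret bound).** For every $\sigma>1$ there is a constant $C>0$, depending only on $\sigma$, such that for all $K\ge1$, all 1-sub-Gaussian reward distributions $\mathcal P_1,\dots,\mathcal P_K$ and all $T\ge1$, MINTS with the uniform prior and the Gaussian likelihood with standard deviation $\sigma$ satisfies $$\mathbb E[\mathcal R(T)]\le C\,\inf_{\delta\ge0}\Big\{\sum_{j:\,\Delta_j>\delta}\Big(\frac{\log(\max\{T\Delta_j^2,e\})}{\Delta_j}+\Delta_j\Big)+T\max_{j:\,\Delta_j\le\delta}\Delta_j\Big\}.$$ -/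

import Mathlib

open MeasureTheory ProbabilityTheory

noncomputable section

namespace MINTS

/-- A dataset of `t` rounds of a `K`-armed bandit: the `i`-th entry is the pair
(arm pulled, reward received). -/
abbrev Dataset (K t : ℕ) : Type := Fin t → Fin K × ℝ

/-- The Gaussian likelihood of the mean vector `θ` given the data `D`, with known standard
deviation `σ`. -/
def likelihood {K t : ℕ} (σ : ℝ) (θ : Fin K → ℝ) (D : Dataset K t) : ℝ :=
  ∏ i, 1 / (√(2 * Real.pi) * σ) * Real.exp (-(θ (D i).1 - (D i).2) ^ 2 / (2 * σ ^ 2))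

/-- The set of mean vectors for which arm `j` is optimal. -/
def optimalSet {K : ℕ} (j : Fin K) : Set (Fin K → ℝ) := {v | ∀ k, v k ≤ v j}

/-- The profile likelihood of the hypothesis that arm `j` is optimal. For `σ > 0` the supremum is
over a nonempty family that is bounded above. -/
def profileLikelihood {K t : ℕ} (σ : ℝ) (j : Fin K) (D : Dataset K t) : ℝ :=
  ⨆ θ : optimalSet j, likelihood σ (θ : Fin K → ℝ) D

/-- The generalized posterior probability of arm `j`, for the prior `Q₀` on the arms. -/
def posterior {K t : ℕ} (σ : ℝ) (Q₀ : Fin K → ℝ) (D : Dataset K t) (j : Fin K) : ℝ :=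
  profileLikelihood σ j D * Q₀ j / ∑ k, profileLikelihood σ k D * Q₀ k

/-- The uniform prior on `K` arms. -/
def uniformPrior (K : ℕ) : Fin K → ℝ := fun _ => 1 / K

lemma continuous_likelihood {K t : ℕ} (σ : ℝ) (θ : Fin K → ℝ) :
    Continuous (fun D : Dataset K t => likelihood σ θ D) := by
  unfold likelihood
  have h : ∀ i : Fin t, Continuous (fun D : Dataset K t => θ (D i).1) := fun i =>
    (continuous_of_discreteTopology (f := θ)).comp (continuous_fst.comp (continuous_apply i))
  fun_prop

lemma abs_likelihood_le {K t : ℕ} (σ : ℝ) (θ : Fin K → ℝ) (D : Dataset K t) :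
    |likelihood σ θ D| ≤ |1 / (√(2 * Real.pi) * σ)| ^ t := by
  unfold likelihood
  rw [Finset.abs_prod]
  refine (Finset.prod_le_prod (fun i _ => abs_nonneg _) (fun i _ => ?_)).trans
    (b := ∏ _i : Fin t, |1 / (√(2 * Real.pi) * σ)|) (by simp)
  rw [abs_mul, Real.abs_exp]
  refine mul_le_of_le_one_right (abs_nonneg _) (Real.exp_le_one_iff.2 ?_)
  exact div_nonpos_of_nonpos_of_nonneg (by nlinarith [sq_nonneg (θ (D i).1 - (D i).2)])
    (by positivity)

lemma bddAbove_likelihood {K t : ℕ} (σ : ℝ) (j : Fin K) (D : Dataset K t) :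
    BddAbove (Set.range fun θ : optimalSet j => likelihood σ (θ : Fin K → ℝ) D) := by
  refine ⟨|1 / (√(2 * Real.pi) * σ)| ^ t, ?_⟩
  rintro _ ⟨θ, rfl⟩
  exact le_of_abs_le (abs_likelihood_le σ (θ : Fin K → ℝ) D)

lemma measurable_profileLikelihood {K t : ℕ} (σ : ℝ) (j : Fin K) :
    Measurable (fun D : Dataset K t => profileLikelihood σ j D) := by
  have h : LowerSemicontinuous (fun D : Dataset K t => profileLikelihood σ j D) :=
    lowerSemicontinuous_ciSup
      (f := fun (θ : optimalSet j) (D : Dataset K t) => likelihood σ (θ : Fin K → ℝ) D)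
      (fun D => bddAbove_likelihood σ j D)
      (fun θ => (continuous_likelihood σ (θ : Fin K → ℝ)).lowerSemicontinuous)
  exact h.measurable

lemma measurable_posterior {K t : ℕ} (σ : ℝ) (Q₀ : Fin K → ℝ) (j : Fin K) :
    Measurable (fun D : Dataset K t => posterior σ Q₀ D j) := by
  have h := fun k => measurable_profileLikelihood (t := t) σ (k : Fin K)
  unfold posterior
  fun_prop

/-- The generalized posterior as a Markov kernel from datasets to arms. -/
def posteriorKernel {K : ℕ} (σ : ℝ) (Q₀ : Fin K → ℝ) (t : ℕ) : Kernel (Dataset K t) (Fin K) where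
  toFun D := ∑ j, ENNReal.ofReal (posterior σ Q₀ D j) • Measure.dirac j
  measurable' := by
    refine Measure.measurable_of_measurable_coe _ fun s _ => ?_
    have h := fun j => measurable_posterior (t := t) σ Q₀ j
    simp only [Measure.coe_finsetSum, Finset.sum_apply, Measure.smul_apply, smul_eq_mul]
    fun_prop

lemma profileLikelihood_pos {K t : ℕ} {σ : ℝ} (hσ : 0 < σ) (j : Fin K) (D : Dataset K t) :
    0 < profileLikelihood σ j D := by
  have h0 : (0 : Fin K → ℝ) ∈ optimalSet j := fun k => le_refl _
  refine lt_of_lt_of_le ?_ (le_ciSup (bddAbove_likelihood σ j D) ⟨0, h0⟩)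
  exact Finset.prod_pos fun i _ => by positivity

lemma isMarkovKernel_posteriorKernel {K : ℕ} (hK : 0 < K) {σ : ℝ} (hσ : 0 < σ) (t : ℕ) :
    IsMarkovKernel (posteriorKernel σ (uniformPrior K) t) := by
  refine ⟨fun D => ⟨?_⟩⟩
  have : NeZero K := ⟨hK.ne'⟩
  have hw : ∀ k : Fin K, 0 < profileLikelihood σ k D * uniformPrior K k := fun k => by
    have := profileLikelihood_pos hσ k D
    unfold uniformPrior
    positivity
  have hs : 0 < ∑ k : Fin K, profileLikelihood σ k D * uniformPrior K k :=
    Finset.sum_pos (fun k _ => hw k) Finset.univ_nonempty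
  change (∑ j, ENNReal.ofReal (posterior σ (uniformPrior K) D j) •
    (Measure.dirac j : Measure (Fin K))) Set.univ = 1
  simp only [Measure.coe_finsetSum, Finset.sum_apply, Measure.smul_apply, smul_eq_mul,
    measure_univ, mul_one]
  unfold posterior
  rw [← ENNReal.ofReal_sum_of_nonneg (fun j _ => (div_pos (hw j) hs).le)]
  rw [← Finset.sum_div, div_self hs.ne', ENNReal.ofReal_one]

/-- The reward mechanism: given the past data and the chosen arm `j`, the reward has law `P j`. -/
def rewardKernel {K : ℕ} (P : Fin K → Measure ℝ) (t : ℕ) : Kernel (Dataset K t × Fin K) ℝ where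
  toFun p := P p.2
  measurable' := (measurable_of_countable P).comp measurable_snd

/-- The dataset formed by the first `t` rounds; rounds are numbered `0, 1, 2, …`. -/
def data {Ω : Type*} {K : ℕ} (x : ℕ → Ω → Fin K) (y : ℕ → Ω → ℝ) (t : ℕ) (ω : Ω) :
    Dataset K t :=
  fun i => (x i ω, y i ω)

/-- `x` (arms) and `y` (rewards) are generated by running minimalist Thompson sampling with prior
`Q₀` and the Gaussian likelihood with standard deviation `σ` on the bandit with reward
distributions `P`: in every round the arm is drawn from the current generalized posterior given
the past data, and the reward is then drawn from the reward distribution of that arm given the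
past data and the arm. -/
structure IsMINTS {Ω : Type*} [MeasurableSpace Ω] (μ : Measure Ω) {K : ℕ} (σ : ℝ)
    (Q₀ : Fin K → ℝ) (P : Fin K → Measure ℝ) (x : ℕ → Ω → Fin K) (y : ℕ → Ω → ℝ) : Prop where
  arm : ∀ t, HasCondDistrib (x t) (data x y t) (posteriorKernel σ Q₀ t) μ
  reward : ∀ t, HasCondDistrib (y t) (fun ω => (data x y t ω, x t ω)) (rewardKernel P t) μ

/-- The expected reward of arm `j`. -/
def armMean {K : ℕ} (P : Fin K → Measure ℝ) (j : Fin K) : ℝ := ∫ r, r ∂(P j)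

/-- The sub-optimality gap of arm `j`. -/
def gap {K : ℕ} (P : Fin K → Measure ℝ) (j : Fin K) : ℝ := (⨆ k, armMean P k) - armMean P j

/-- The regret of the first `T` decisions. -/
def regret {Ω : Type*} {K : ℕ} (P : Fin K → Measure ℝ) (x : ℕ → Ω → Fin K) (T : ℕ) (ω : Ω) : ℝ :=
  ∑ t ∈ Finset.range T, ((⨆ k, armMean P k) - armMean P (x t ω))

/-- Every reward distribution is 1-sub-Gaussian around its mean. -/
def SubGaussianRewards {K : ℕ} (P : Fin K → Measure ℝ) : Prop :=
  ∀ j, HasSubgaussianMGF (fun r => r - armMean P j) 1 (P j)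

open scoped Classical in
/-- The quantity inside the infimum, at level `δ`. -/
def regretBound {K : ℕ} (P : Fin K → Measure ℝ) (T : ℕ) (δ : ℝ) : ℝ :=
  ∑ j with δ < gap P j,
      (Real.log (max (T * gap P j ^ 2) (Real.exp 1)) / gap P j + gap P j)
    + T * ⨆ j : {j : Fin K // gap P j ≤ δ}, gap P j

end MINTS

end

/-!
Fix a suboptimal arm `j` with mean `c` and gap `Δ`, and an optimal arm `k` with mean `c + Δ`. The
expected number of pulls of `j` is shown to be `O(1 + log (max (T * Δ ^ 2) e) / Δ ^ 2)`; the regret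
bound follows by summing over the arms with gap above `δ` and charging at most the largest gap below
`δ` to every remaining round.

*Comparison of posteriors* (`posterior_le`). Write `N` and `S` for the number of pulls and the
centred reward sum of an arm. A mean vector `θ` for which `j` is optimal falls in one of two classes.
If `θ j` is at least the midpoint `c + Δ / 2` and the empirical mean of `j` is at most `c + Δ / 4`,
then lowering `θ j` to `c + Δ / 4` multiplies the likelihood by at least
`exp (N_j * Δ ^ 2 / (32 * σ ^ 2))`, and the new vector still makes some arm optimal. If `θ j` is below
the midpoint, then so are all coordinates of `θ`, and raising `θ k` to `c + 3 / 4 * Δ` makes `k`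
optimal; the change of likelihood involves only `N_k` and `S_k` and is bounded by `oddsBound`. Hence
the posterior probability of `j` is at most an exponentially small term plus `oddsBound` times the
posterior probability of `k`. Only the one optimal arm `k` enters, so no factor `K` is lost.

*From the posterior to pulls of the optimal arm.* Since the posterior probability of `k` is the
conditional probability of pulling `k`, the second term, summed over all rounds, is the expectation of
`oddsBound` summed over the rounds in which `k` is pulled, that is, over the values of `N_k`.

*Tail bounds* (`IsMINTS.sum_tail_le`). The process `exp (l * S - l ^ 2 / 2 * N)` is a nonnegative
supermartingale. Stopping it when an arm is about to be pulled for the `(n + 1)`-st time gives Chernoff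
bounds for `S` after `n` pulls. For `j` these make overestimation summable in `n`. For `k` they bound
the mean of `exp (S ^ 2 / (2 * n * σ ^ 2))` on the event that the empirical mean is too low by `Δ / 4`
(`IsMINTS.sum_exp_sq_le`); this is finite, and exponentially small in `n`, exactly because `1 < σ`.
-/

noncomputable section

namespace MINTS

open scoped ENNReal

/-! ### Sufficient statistics and the Gaussian likelihood -/

/-- The number of pulls of arm `j` in the dataset `D`. -/
def pulls {K t : ℕ} (j : Fin K) (D : Dataset K t) : ℕ :=
  ∑ i, if (D i).1 = j then 1 else 0

/-- The sum of the rewards of arm `j` in the dataset `D`, each centred at `c`. -/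
def centeredSum {K t : ℕ} (c : ℝ) (j : Fin K) (D : Dataset K t) : ℝ :=
  ∑ i, if (D i).1 = j then (D i).2 - c else 0

lemma measurable_pulls {K t : ℕ} (j : Fin K) :
    Measurable (fun D : Dataset K t => pulls j D) := by
  unfold pulls
  refine Finset.measurable_sum _ fun i _ => ?_
  exact Measurable.ite (measurableSet_eq_fun (by fun_prop) measurable_const)
    measurable_const measurable_const

lemma measurable_centeredSum {K t : ℕ} (c : ℝ) (j : Fin K) :
    Measurable (fun D : Dataset K t => centeredSum c j D) := by
  unfold centeredSum
  refine Finset.measurable_sum _ fun i _ => ?_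
  exact Measurable.ite (measurableSet_eq_fun (by fun_prop) measurable_const)
    (by fun_prop) measurable_const

lemma pulls_le {K t : ℕ} (j : Fin K) (D : Dataset K t) : pulls j D ≤ t := by
  unfold pulls
  calc _ ≤ ∑ _i : Fin t, 1 := Finset.sum_le_sum fun i _ => by split_ifs <;> simp
    _ = t := by simp

lemma centeredSum_eq_zero {K t : ℕ} (c : ℝ) {j : Fin K} {D : Dataset K t} (h : pulls j D = 0) :
    centeredSum c j D = 0 := by
  unfold pulls at h
  rw [Finset.sum_eq_zero_iff] at h
  refine Finset.sum_eq_zero fun i hi => ?_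
  have := h i hi
  simp_all

lemma likelihood_nonneg {K t : ℕ} {σ : ℝ} (hσ : 0 < σ) (θ : Fin K → ℝ) (D : Dataset K t) :
    0 ≤ likelihood σ θ D :=
  Finset.prod_nonneg fun i _ => by positivity

/-- Moving the `j`-th coordinate of the mean vector multiplies the Gaussian likelihood by a factor
that depends on the data only through the number of pulls and the centred reward sum of `j`. -/
lemma likelihood_eq_update {K t : ℕ} {σ : ℝ} (c : ℝ) (j : Fin K) (b : ℝ) (θ : Fin K → ℝ)
    (D : Dataset K t) :
    likelihood σ θ D = likelihood σ (Function.update θ j b) D *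
      Real.exp (-(pulls j D * ((θ j - c) ^ 2 - (b - c) ^ 2)
        - 2 * (θ j - b) * centeredSum c j D) / (2 * σ ^ 2)) := by
  have h : -(pulls j D * ((θ j - c) ^ 2 - (b - c) ^ 2)
        - 2 * (θ j - b) * centeredSum c j D) / (2 * σ ^ 2) =
      ∑ i, if (D i).1 = j then
        -(((θ j - c) ^ 2 - (b - c) ^ 2) - 2 * (θ j - b) * ((D i).2 - c)) / (2 * σ ^ 2) else 0 := by
    unfold pulls centeredSum
    push_cast
    rw [Finset.sum_mul, Finset.mul_sum, ← Finset.sum_sub_distrib, ← Finset.sum_neg_distrib,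
      Finset.sum_div]
    refine Finset.sum_congr rfl fun i _ => ?_
    split_ifs <;> simp
  rw [h, Real.exp_sum]
  unfold likelihood
  rw [← Finset.prod_mul_distrib]
  refine Finset.prod_congr rfl fun i _ => ?_
  rw [mul_assoc, ← Real.exp_add]
  congr 2
  split_ifs with hi
  · rw [hi, Function.update_self]
    ring
  · rw [Function.update_of_ne hi]
    ring

lemma likelihood_le_profileLikelihood {K t : ℕ} (σ : ℝ) {j : Fin K} {θ : Fin K → ℝ}
    (hθ : θ ∈ optimalSet j) (D : Dataset K t) : likelihood σ θ D ≤ profileLikelihood σ j D :=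
  le_ciSup (bddAbove_likelihood σ j D) ⟨θ, hθ⟩

lemma likelihood_le_sum_profileLikelihood {K t : ℕ} {σ : ℝ} (hσ : 0 < σ) (hK : 0 < K)
    (θ : Fin K → ℝ) (D : Dataset K t) :
    likelihood σ θ D ≤ ∑ l, profileLikelihood σ l D := by
  have : NeZero K := ⟨hK.ne'⟩
  obtain ⟨l, hl⟩ := Finite.exists_max θ
  exact (likelihood_le_profileLikelihood σ (j := l) hl D).trans
    (Finset.single_le_sum (fun k _ => (profileLikelihood_pos hσ k D).le) (Finset.mem_univ l))

/-! ### Comparison of posterior probabilities -/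

/-- A bound for the posterior odds of a suboptimal arm with gap `Δ` against an optimal arm that has
been pulled `n` times with centred reward sum `s`, as far as these odds come from mean vectors that
give the suboptimal arm a value below the midpoint of the two means. For `n = 0` the division by
zero produces the intended value `exp 0`. -/
def oddsBound (σ Δ : ℝ) (n : ℕ) (s : ℝ) : ℝ :=
  Real.exp (-(n * (Δ ^ 2 / (32 * σ ^ 2)))) +
    if s ≤ -(n * (Δ / 4)) then Real.exp (s ^ 2 / (2 * n) / σ ^ 2) else 0

lemma oddsBound_nonneg (σ Δ : ℝ) (n : ℕ) (s : ℝ) : 0 ≤ oddsBound σ Δ n s := by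
  unfold oddsBound
  split_ifs <;> positivity

/-- Mean vectors giving arm `j` a value above the midpoint `c + Δ / 2` fit the rewards of `j` badly:
lowering the `j`-th coordinate to `c + Δ / 4` improves the likelihood exponentially. -/
lemma likelihood_le_of_le {K t : ℕ} {σ : ℝ} (hσ : 0 < σ) (hK : 0 < K) {j : Fin K} {c Δ : ℝ}
    (hΔ : 0 < Δ) {D : Dataset K t} (hS : centeredSum c j D ≤ pulls j D * (Δ / 4))
    {θ : Fin K → ℝ} (hθ : c + Δ / 2 ≤ θ j) :
    likelihood σ θ D ≤ Real.exp (-(pulls j D * (Δ ^ 2 / (32 * σ ^ 2)))) *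
      ∑ l, profileLikelihood σ l D := by
  rw [likelihood_eq_update c j (c + Δ / 4), mul_comm]
  refine mul_le_mul (Real.exp_le_exp.2 ?_) (likelihood_le_sum_profileLikelihood hσ hK _ D)
    (likelihood_nonneg hσ _ D) (Real.exp_pos _).le
  rw [show -(pulls j D * (Δ ^ 2 / (32 * σ ^ 2)) : ℝ) =
    -(pulls j D * (Δ ^ 2 / 16)) / (2 * σ ^ 2) by field_simp; ring]
  gcongr
  have h1 : 0 ≤ θ j - (c + Δ / 4) := by linarith
  have h2 := mul_le_mul_of_nonneg_left hS h1
  have h3 : (Δ / 4) ^ 2 ≤ (θ j - (c + Δ / 4)) ^ 2 := by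
    apply pow_le_pow_left₀ <;> linarith
  have h4 := mul_le_mul_of_nonneg_left h3 (Nat.cast_nonneg (α := ℝ) (pulls j D))
  nlinarith

/-- If `j` is optimal for a mean vector at a value below `c + Δ / 2`, then raising the value of the
arm `k` with true mean `c + Δ` to `c + 3 / 4 * Δ` makes `k` optimal. -/
lemma likelihood_le_of_lt {K t : ℕ} {σ : ℝ} (hσ : 0 < σ) {j : Fin K} (k : Fin K) {c d Δ : ℝ}
    (hΔ : 0 < Δ) (hd : d = c + Δ) (D : Dataset K t)
    {θ : Fin K → ℝ} (hj : θ ∈ optimalSet j) (hθ : θ j < c + Δ / 2) :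
    likelihood σ θ D ≤ profileLikelihood σ k D *
      oddsBound σ Δ (pulls k D) (centeredSum d k D) := by
  have hmem : Function.update θ k (d - Δ / 4) ∈ optimalSet k := by
    intro l
    rw [Function.update_self]
    rcases eq_or_ne l k with rfl | hl
    · rw [Function.update_self]
    · rw [Function.update_of_ne hl]
      have := hj l
      linarith
  have ha : θ k - d ≤ -(Δ / 2) := by
    have := hj k
    linarith
  rw [likelihood_eq_update d k (d - Δ / 4)]
  refine mul_le_mul (likelihood_le_profileLikelihood σ hmem D) ?_ (Real.exp_pos _).le
    (profileLikelihood_pos hσ k D).le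
  have h0 : centeredSum d k D < 0 → (pulls k D : ℝ) ≠ 0 := fun h h' => by
    rw [centeredSum_eq_zero d (by exact_mod_cast h')] at h
    exact lt_irrefl _ h
  generalize centeredSum d k D = S at *
  have hn := Nat.cast_nonneg (α := ℝ) (pulls k D)
  unfold oddsBound
  generalize (pulls k D : ℝ) = n at *
  generalize ha' : θ k - d = a at *
  rw [show θ k - (d - Δ / 4) = a + Δ / 4 by rw [← ha']; ring,
    show d - Δ / 4 - d = -(Δ / 4) by ring]
  split_ifs with hs
  · refine le_add_of_nonneg_of_le (Real.exp_pos _).le (Real.exp_le_exp.2 ?_)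
    rcases hn.eq_or_lt with rfl | hn
    · have : S = 0 := by
        by_contra h
        exact h0 (lt_of_le_of_ne (by simpa using hs) h) rfl
      simp [this]
    · rw [show S ^ 2 / (2 * n) / σ ^ 2 = (S ^ 2 / n) / (2 * σ ^ 2) by field_simp]
      gcongr
      rw [le_div_iff₀ hn]
      have h1 : 0 ≤ (n * (Δ / 4)) * (-(n * (Δ / 4)) - 2 * S) := by
        have : 0 ≤ n * (Δ / 4) := by positivity
        exact mul_nonneg this (by linarith)
      nlinarith [sq_nonneg (n * a - S)]
  · rw [add_zero, Real.exp_le_exp, show -(n * (Δ ^ 2 / (32 * σ ^ 2)) : ℝ) =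
      -(n * (Δ ^ 2 / 16)) / (2 * σ ^ 2) by field_simp; ring]
    gcongr
    have h1 : 0 ≤ -(a + Δ / 4) := by linarith
    have h2 := mul_le_mul_of_nonneg_left (not_le.1 hs).le h1
    have h3 : (Δ / 4) ^ 2 ≤ (-(a + Δ / 4)) ^ 2 := by
      apply pow_le_pow_left₀ <;> linarith
    have h4 := mul_le_mul_of_nonneg_left h3 hn
    nlinarith

lemma posterior_uniformPrior {K t : ℕ} (hK : 0 < K) (σ : ℝ) (D : Dataset K t) (j : Fin K) :
    posterior σ (uniformPrior K) D j =
      profileLikelihood σ j D / ∑ l, profileLikelihood σ l D := by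
  have : (K : ℝ) ≠ 0 := by positivity
  unfold posterior uniformPrior
  rw [← Finset.sum_mul, mul_div_mul_right _ _ (by positivity)]

lemma posterior_nonneg {K t : ℕ} (hK : 0 < K) {σ : ℝ} (hσ : 0 < σ) (D : Dataset K t)
    (j : Fin K) : 0 ≤ posterior σ (uniformPrior K) D j := by
  rw [posterior_uniformPrior hK]
  exact div_nonneg (profileLikelihood_pos hσ j D).le
    (Finset.sum_nonneg fun l _ => (profileLikelihood_pos hσ l D).le)

/-- When the empirical mean of the suboptimal arm `j` is at most `c + Δ / 4`, its posterior
probability is exponentially small in its number of pulls, up to a multiple of the posterior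
probability of the arm `k` that depends on the rewards of `k` alone. -/
lemma posterior_le {K t : ℕ} (hK : 0 < K) {σ : ℝ} (hσ : 0 < σ) {j : Fin K} (k : Fin K)
    {c d Δ : ℝ} (hΔ : 0 < Δ) (hd : d = c + Δ) {D : Dataset K t}
    (hS : centeredSum c j D ≤ pulls j D * (Δ / 4)) :
    posterior σ (uniformPrior K) D j ≤
      Real.exp (-(pulls j D * (Δ ^ 2 / (32 * σ ^ 2)))) +
        posterior σ (uniformPrior K) D k *
          oddsBound σ Δ (pulls k D) (centeredSum d k D) := by
  have : NeZero K := ⟨hK.ne'⟩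
  have hpos : 0 < ∑ l, profileLikelihood σ l D :=
    Finset.sum_pos (fun l _ => profileLikelihood_pos hσ l D) Finset.univ_nonempty
  have hW := oddsBound_nonneg σ Δ (pulls k D) (centeredSum d k D)
  rw [posterior_uniformPrior hK, posterior_uniformPrior hK, div_le_iff₀ hpos, add_mul,
    mul_right_comm, div_mul_cancel₀ _ hpos.ne']
  have : Nonempty (optimalSet j) := ⟨0, fun k => le_refl _⟩
  refine ciSup_le fun θ => ?_
  rcases le_or_gt (c + Δ / 2) (θ.1 j) with h | h
  · exact (likelihood_le_of_le hσ hK hΔ hS h).trans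
      (le_add_of_nonneg_right (mul_nonneg (profileLikelihood_pos hσ k D).le hW))
  · exact (likelihood_le_of_lt hσ k hΔ hd D θ.2 h).trans
      (le_add_of_nonneg_left (by positivity))

/-! ### The reward process and its exponential supermartingale -/

lemma lintegral_hasCondDistrib {Ω α β : Type*} [MeasurableSpace Ω] [MeasurableSpace α]
    [MeasurableSpace β] {μ : Measure Ω} [IsFiniteMeasure μ] {X : Ω → α} {Y : Ω → β}
    {κ : Kernel α β} [IsMarkovKernel κ] (h : HasCondDistrib Y X κ μ) {f : α → β → ℝ≥0∞}
    (hf : Measurable (Function.uncurry f)) :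
    ∫⁻ ω, f (X ω) (Y ω) ∂μ = ∫⁻ ω, ∫⁻ b, f (X ω) b ∂(κ (X ω)) ∂μ := by
  have h1 : ∫⁻ ω, f (X ω) (Y ω) ∂μ
      = ∫⁻ p, Function.uncurry f p ∂(μ.map fun ω => (X ω, Y ω)) :=
    (lintegral_map' hf.aemeasurable h.aemeasurable).symm
  rw [h1, h.map_eq, Measure.lintegral_compProd hf,
    lintegral_map' (Measurable.lintegral_kernel_prod_right' hf).aemeasurable h.aemeasurable_fst]
  rfl

lemma isMarkovKernel_rewardKernel {K : ℕ} {P : Fin K → Measure ℝ}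
    (hP : ∀ j, IsProbabilityMeasure (P j)) (t : ℕ) : IsMarkovKernel (rewardKernel P t) :=
  ⟨fun p => hP p.2⟩

lemma pulls_data_zero {Ω : Type*} {K : ℕ} (x : ℕ → Ω → Fin K) (y : ℕ → Ω → ℝ) (j : Fin K)
    (ω : Ω) : pulls j (data x y 0 ω) = 0 := by
  simp [pulls]

lemma centeredSum_data_zero {Ω : Type*} {K : ℕ} (x : ℕ → Ω → Fin K) (y : ℕ → Ω → ℝ) (c : ℝ)
    (j : Fin K) (ω : Ω) : centeredSum c j (data x y 0 ω) = 0 := by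
  simp [centeredSum]

lemma pulls_data_succ {Ω : Type*} {K : ℕ} (x : ℕ → Ω → Fin K) (y : ℕ → Ω → ℝ) (j : Fin K)
    (t : ℕ) (ω : Ω) : pulls j (data x y (t + 1) ω) =
      pulls j (data x y t ω) + if x t ω = j then 1 else 0 := by
  simp [pulls, data, Fin.sum_univ_castSucc]
  rfl

lemma centeredSum_data_succ {Ω : Type*} {K : ℕ} (x : ℕ → Ω → Fin K) (y : ℕ → Ω → ℝ) (c : ℝ)
    (j : Fin K) (t : ℕ) (ω : Ω) : centeredSum c j (data x y (t + 1) ω) =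
      centeredSum c j (data x y t ω) + if x t ω = j then y t ω - c else 0 := by
  simp [centeredSum, data, Fin.sum_univ_castSucc]
  rfl

/-- The exponential supermartingale `exp (l * S - l ^ 2 / 2 * N)` attached to the centred reward
sum `S` and the number of pulls `N` of one arm. -/
def expMart {K t : ℕ} (l c : ℝ) (j : Fin K) (D : Dataset K t) : ℝ≥0∞ :=
  ENNReal.ofReal (Real.exp (l * centeredSum c j D - l ^ 2 / 2 * pulls j D))

lemma measurable_natCast_pulls {K t : ℕ} (j : Fin K) :
    Measurable (fun D : Dataset K t => (pulls j D : ℝ)) :=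
  (measurable_from_top (f := fun n : ℕ => (n : ℝ))).comp (measurable_pulls j)

lemma measurable_expMart {K t : ℕ} (l c : ℝ) (j : Fin K) :
    Measurable (fun D : Dataset K t => expMart l c j D) := by
  have h1 := measurable_natCast_pulls (t := t) j
  have h2 := measurable_centeredSum (t := t) c j
  unfold expMart
  fun_prop

lemma lintegral_exp_sub_le_one {K : ℕ} {P : Fin K → Measure ℝ}
    (hsub : SubGaussianRewards P) (l : ℝ) (j : Fin K) :
    ∫⁻ r, ENNReal.ofReal (Real.exp (l * (r - armMean P j) - l ^ 2 / 2)) ∂(P j) ≤ 1 := by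
  have h := (hsub j).mgf_le l
  have hi := (hsub j).integrable_exp_mul l
  simp only [Real.exp_sub]
  rw [← ofReal_integral_eq_lintegral_ofReal (hi.div_const _)
    (Filter.Eventually.of_forall fun r => by positivity), integral_div]
  rw [ENNReal.ofReal_le_one, div_le_one (Real.exp_pos _)]
  refine h.trans (le_of_eq ?_)
  norm_num

section Interaction

variable {Ω : Type*} [MeasurableSpace Ω] {μ : Measure Ω} {K : ℕ}
  {σ : ℝ} {Q₀ : Fin K → ℝ} {P : Fin K → Measure ℝ} {x : ℕ → Ω → Fin K} {y : ℕ → Ω → ℝ}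

lemma IsMINTS.aemeasurable_comp (h : IsMINTS μ σ Q₀ P x y) (t : ℕ) (c : ℝ) (k : Fin K)
    {G : Fin K → ℕ → ℝ → ℝ≥0∞} (hG : ∀ i n, Measurable (G i n)) :
    AEMeasurable (fun ω => G (x t ω) (pulls k (data x y t ω)) (centeredSum c k (data x y t ω)))
      μ := by
  have h1 : Measurable fun p : (Fin K × ℕ) × ℝ => G p.1.1 p.1.2 p.2 :=
    measurable_from_prod_countable_right fun p => hG p.1 p.2
  have h2 : Measurable fun p : Dataset K t × Fin K =>
      ((p.2, pulls k p.1), centeredSum c k p.1) :=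
    (measurable_snd.prodMk ((measurable_pulls k).comp measurable_fst)).prodMk
      ((measurable_centeredSum c k).comp measurable_fst)
  exact (h1.comp h2).comp_aemeasurable (h.reward t).aemeasurable_fst

/-- Sorting the rounds in which arm `j` is pulled by the number of earlier pulls of `j`. -/
lemma IsMINTS.sum_lintegral_le_sum_sum (h : IsMINTS μ σ Q₀ P x y) (c : ℝ) (j : Fin K) (T : ℕ)
    {f : ℕ → ℝ → ℝ≥0∞} (hf : ∀ n, Measurable (f n)) :
    ∑ t ∈ Finset.range T, ∫⁻ ω, (if x t ω = j then
        f (pulls j (data x y t ω)) (centeredSum c j (data x y t ω)) else 0) ∂μ ≤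
      ∑ n ∈ Finset.range T, ∑ t ∈ Finset.range T, ∫⁻ ω, (if x t ω = j ∧
        pulls j (data x y t ω) = n then f n (centeredSum c j (data x y t ω)) else 0) ∂μ := by
  rw [Finset.sum_comm]
  refine Finset.sum_le_sum fun t ht => ?_
  rw [← lintegral_finsetSum' _ fun n _ => h.aemeasurable_comp t c j
    (G := fun i m s => if i = j ∧ m = n then f n s else 0) fun i m =>
      Measurable.ite (MeasurableSet.const _) (hf n) measurable_const]
  refine lintegral_mono fun ω => ?_
  dsimp only
  split_ifs with hx
  · refine le_trans (le_of_eq ?_) (Finset.single_le_sum (fun _ _ => zero_le)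
      (Finset.mem_range.2 ((pulls_le j (data x y t ω)).trans_lt (Finset.mem_range.1 ht))))
    simp [hx]
  · exact zero_le

variable [IsProbabilityMeasure μ]

/-- The law of the arm pulled in round `t`, given the past, is the posterior. -/
lemma IsMINTS.lintegral_arm (hK : 0 < K) (hσ : 0 < σ)
    (h : IsMINTS μ σ (uniformPrior K) P x y) (t : ℕ) (j : Fin K)
    {f : Dataset K t → ℝ≥0∞} (hf : Measurable f) :
    ∫⁻ ω, (if x t ω = j then f (data x y t ω) else 0) ∂μ =
      ∫⁻ ω, f (data x y t ω) *
        ENNReal.ofReal (posterior σ (uniformPrior K) (data x y t ω) j) ∂μ := by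
  have := isMarkovKernel_posteriorKernel hK hσ t
  have hm : Measurable (Function.uncurry fun (D : Dataset K t) (i : Fin K) =>
      if i = j then f D else 0) :=
    Measurable.ite (measurableSet_eq_fun measurable_snd measurable_const)
      (hf.comp measurable_fst) measurable_const
  rw [lintegral_hasCondDistrib (h.arm t) hm]
  refine lintegral_congr fun ω => ?_
  change ∫⁻ b, _ ∂(∑ j, ENNReal.ofReal (posterior σ (uniformPrior K) (data x y t ω) j) •
    (Measure.dirac j : Measure (Fin K))) = _
  rw [lintegral_finsetSum_measure]
  simp only [lintegral_smul_measure, lintegral_dirac, smul_eq_mul, mul_ite, mul_zero,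
    Finset.sum_ite_eq', Finset.mem_univ, if_true]
  rw [mul_comm]

/-- Up to the round in which arm `j` is pulled for the `(n + 1)`-st time, the process `expMart` is
a supermartingale; in that round its value is charged to the first summand. -/
lemma IsMINTS.lintegral_expMart_step (hP : ∀ j, IsProbabilityMeasure (P j))
    (hsub : SubGaussianRewards P) (h : IsMINTS μ σ Q₀ P x y) (l : ℝ) (j : Fin K) (n t : ℕ) :
    ∫⁻ ω, (if x t ω = j ∧ pulls j (data x y t ω) = n
          then expMart l (armMean P j) j (data x y t ω) else 0) ∂μ +
      ∫⁻ ω, (if pulls j (data x y (t + 1) ω) ≤ n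
          then expMart l (armMean P j) j (data x y (t + 1) ω) else 0) ∂μ ≤
      ∫⁻ ω, (if pulls j (data x y t ω) ≤ n
          then expMart l (armMean P j) j (data x y t ω) else 0) ∂μ := by
  have := isMarkovKernel_rewardKernel hP t
  set c := armMean P j
  let H : Dataset K t × Fin K → ℝ≥0∞ := fun p =>
    if pulls j p.1 + (if p.2 = j then 1 else 0) ≤ n then expMart l c j p.1 else 0
  let g : Fin K → ℝ → ℝ≥0∞ := fun i r =>
    if i = j then ENNReal.ofReal (Real.exp (l * (r - c) - l ^ 2 / 2)) else 1
  have hpm : Measurable fun p : Dataset K t × Fin K => pulls j p.1 :=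
    (measurable_pulls j).comp measurable_fst
  have hem : Measurable fun p : Dataset K t × Fin K => expMart l c j p.1 :=
    (measurable_expMart l c j).comp measurable_fst
  have hHm : Measurable H :=
    Measurable.ite (measurableSet_le (hpm.add (Measurable.ite
      (measurableSet_eq_fun measurable_snd measurable_const) measurable_const measurable_const))
      measurable_const) hem measurable_const
  have hgm : Measurable (Function.uncurry g) :=
    Measurable.ite (measurableSet_eq_fun measurable_fst measurable_const)
      (by fun_prop) measurable_const
  have hstep : ∀ ω, (if pulls j (data x y (t + 1) ω) ≤ n
      then expMart l c j (data x y (t + 1) ω) else 0) =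
      H (data x y t ω, x t ω) * g (x t ω) (y t ω) := by
    intro ω
    simp only [H, g, expMart, pulls_data_succ, centeredSum_data_succ]
    by_cases hx : x t ω = j
    · simp only [hx, if_true]
      split_ifs
      · rw [← ENNReal.ofReal_mul (Real.exp_pos _).le, ← Real.exp_add]
        congr 2
        push_cast
        ring
      · rw [zero_mul]
    · simp [hx]
  have hg : ∀ i, ∫⁻ r, g i r ∂(P i) ≤ 1 := by
    intro i
    by_cases hi : i = j
    · subst hi
      simpa [g] using lintegral_exp_sub_le_one hsub l i
    · simp [g, hi]
  have hle : ∫⁻ ω, (if pulls j (data x y (t + 1) ω) ≤ n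
      then expMart l c j (data x y (t + 1) ω) else 0) ∂μ ≤
      ∫⁻ ω, H (data x y t ω, x t ω) ∂μ := by
    simp_rw [hstep]
    rw [lintegral_hasCondDistrib (h.reward t)
      (f := fun p r => H p * g p.2 r)
      ((hHm.comp measurable_fst).mul
        (hgm.comp ((measurable_snd.comp measurable_fst).prodMk measurable_snd)))]
    refine lintegral_mono fun ω => ?_
    rw [lintegral_const_mul (r := H (data x y t ω, x t ω)) (f := fun r => g (x t ω) r)
      (hf := hgm.comp (measurable_const.prodMk measurable_id))]
    exact mul_le_of_le_one_right (zero_le) (hg _)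
  refine (add_le_add_right hle _).trans ?_
  rw [← lintegral_add_right' (g := fun ω => H (data x y t ω, x t ω)) _
    (hHm.comp_aemeasurable (h.reward t).aemeasurable_fst)]
  refine lintegral_mono fun ω => ?_
  simp only [H]
  generalize pulls j (data x y t ω) = m
  generalize expMart l c j (data x y t ω) = e
  split_ifs <;> first | omega | simp

/-- Summed over the rounds, the value of the supermartingale when arm `j` is about to be pulled
for the `(n + 1)`-st time has mean at most one. -/
lemma IsMINTS.sum_lintegral_expMart_le_one (hP : ∀ j, IsProbabilityMeasure (P j))
    (hsub : SubGaussianRewards P) (h : IsMINTS μ σ Q₀ P x y) (l : ℝ) (j : Fin K) (n T : ℕ) :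
    ∑ t ∈ Finset.range T, ∫⁻ ω, (if x t ω = j ∧ pulls j (data x y t ω) = n
          then expMart l (armMean P j) j (data x y t ω) else 0) ∂μ ≤ 1 := by
  suffices hT : ∑ t ∈ Finset.range T, ∫⁻ ω, (if x t ω = j ∧ pulls j (data x y t ω) = n
        then expMart l (armMean P j) j (data x y t ω) else 0) ∂μ +
      ∫⁻ ω, (if pulls j (data x y T ω) ≤ n
        then expMart l (armMean P j) j (data x y T ω) else 0) ∂μ ≤ 1 from
    le_self_add.trans hT
  induction T with
  | zero => simp [expMart, pulls_data_zero, centeredSum_data_zero]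
  | succ T ih =>
    rw [Finset.sum_range_succ, add_assoc]
    exact (add_le_add_right (h.lintegral_expMart_step hP hsub l j n T) _).trans ih

/-- A Chernoff bound for the centred reward sum of arm `j` after `n` pulls; the sign of `l` selects
the tail. -/
lemma IsMINTS.sum_tail_le (hP : ∀ j, IsProbabilityMeasure (P j))
    (hsub : SubGaussianRewards P) (h : IsMINTS μ σ Q₀ P x y) (l : ℝ) (j : Fin K) (n T : ℕ) :
    ∑ t ∈ Finset.range T, ∫⁻ ω, (if x t ω = j ∧ pulls j (data x y t ω) = n then
          (if l ^ 2 * n ≤ l * centeredSum (armMean P j) j (data x y t ω) then 1 else 0)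
          else 0) ∂μ ≤
      ENNReal.ofReal (Real.exp (-(n * (l ^ 2 / 2)))) := by
  calc _ ≤ ∑ t ∈ Finset.range T, ∫⁻ ω, ENNReal.ofReal (Real.exp (-(n * (l ^ 2 / 2)))) *
        (if x t ω = j ∧ pulls j (data x y t ω) = n
          then expMart l (armMean P j) j (data x y t ω) else 0) ∂μ := by
        refine Finset.sum_le_sum fun t _ => lintegral_mono fun ω => ?_
        dsimp only
        split_ifs with h1 h2
        · rw [expMart, ← ENNReal.ofReal_mul (Real.exp_pos _).le, ← Real.exp_add,
            ENNReal.one_le_ofReal, Real.one_le_exp_iff, h1.2]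
          linarith
        · exact zero_le
        · exact zero_le
    _ = ENNReal.ofReal (Real.exp (-(n * (l ^ 2 / 2)))) * _ := by
        rw [Finset.mul_sum]
        exact Finset.sum_congr rfl fun t _ => lintegral_const_mul' _ _ ENNReal.ofReal_ne_top
    _ ≤ _ := mul_le_of_le_one_right (zero_le)
        (h.sum_lintegral_expMart_le_one hP hsub l j n T)

lemma IsMINTS.sum_pulls_eq_le_one (hP : ∀ j, IsProbabilityMeasure (P j))
    (hsub : SubGaussianRewards P) (h : IsMINTS μ σ Q₀ P x y) (j : Fin K) (n T : ℕ) :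
    ∑ t ∈ Finset.range T,
      ∫⁻ ω, (if x t ω = j ∧ pulls j (data x y t ω) = n then 1 else 0) ∂μ ≤ 1 := by
  simpa using h.sum_tail_le hP hsub 0 j n T

end Interaction

/-! ### Geometric sums -/

lemma sum_exp_neg_mul_le {a : ℝ} (ha : 0 < a) (T : ℕ) :
    ∑ n ∈ Finset.range T, Real.exp (-(n * a)) ≤ 1 + 1 / a := by
  have h1 : Real.exp (-a) < 1 := by simpa using ha
  have h2 : Real.exp (-a) ≤ (1 + a)⁻¹ := by
    rw [Real.exp_neg]
    gcongr
    linarith [Real.add_one_le_exp a]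
  calc ∑ n ∈ Finset.range T, Real.exp (-(n * a))
      = ∑ n ∈ Finset.range T, Real.exp (-a) ^ n := by
        refine Finset.sum_congr rfl fun n _ => ?_
        rw [← Real.exp_nat_mul]
        congr 1
        ring
    _ ≤ (1 - Real.exp (-a))⁻¹ := by
        rw [← tsum_geometric_of_lt_one (Real.exp_pos _).le h1]
        exact (summable_geometric_of_lt_one (Real.exp_pos _).le h1).sum_le_tsum _
          fun _ _ => by positivity
    _ ≤ (1 - (1 + a)⁻¹)⁻¹ := by
        have : (1 + a)⁻¹ < 1 := inv_lt_one_of_one_lt₀ (by linarith)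
        gcongr
    _ = 1 + 1 / a := by
        have : 1 - (1 + a)⁻¹ = a / (1 + a) := by
          field_simp
          ring
        rw [this, inv_div, add_div, div_self ha.ne', add_comm]

lemma sum_ofReal_exp_neg_mul_le {a : ℝ} (ha : 0 < a) (T : ℕ) :
    ∑ n ∈ Finset.range T, ENNReal.ofReal (Real.exp (-(n * a))) ≤ ENNReal.ofReal (1 + 1 / a) := by
  rw [← ENNReal.ofReal_sum_of_nonneg fun _ _ => (Real.exp_pos _).le]
  exact ENNReal.ofReal_le_ofReal (sum_exp_neg_mul_le ha T)

/-- The constant in the bound for `exp (X / σ ^ 2)` on the event `u ≤ X` when `X` has standard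
exponential tails; it is finite because `1 < σ`. -/
def tailConst (σ : ℝ) : ℝ :=
  Real.exp (1 / σ ^ 2) / (1 - Real.exp (-(1 - 1 / σ ^ 2)))

lemma one_sub_one_div_sq_pos {σ : ℝ} (hσ : 1 < σ) : 0 < 1 - 1 / σ ^ 2 := by
  have : 1 < σ ^ 2 := one_lt_pow₀ hσ (by norm_num)
  rw [sub_pos, div_lt_one (by linarith)]
  exact this

lemma one_le_tailConst {σ : ℝ} (hσ : 1 < σ) : 1 ≤ tailConst σ := by
  have h := one_sub_one_div_sq_pos hσ
  have h1 : Real.exp (-(1 - 1 / σ ^ 2)) < 1 := by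
    rw [Real.exp_lt_one_iff]
    linarith
  unfold tailConst
  rw [one_le_div (by linarith)]
  have h2 : 1 ≤ Real.exp (1 / σ ^ 2) := Real.one_le_exp (by positivity)
  linarith [Real.exp_pos (-(1 - 1 / σ ^ 2))]

/-- Cutting `[u, ∞)` into unit intervals. -/
lemma ofReal_exp_le_tsum {q u X : ℝ} (hq : 0 ≤ q) (hX : u ≤ X) :
    ENNReal.ofReal (Real.exp (q * X)) ≤
      ∑' k : ℕ, if u + k ≤ X then ENNReal.ofReal (Real.exp (q * (u + k + 1))) else 0 := by
  have h0 : 0 ≤ X - u := by linarith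
  refine le_trans ?_ (ENNReal.le_tsum ⌊X - u⌋₊)
  have h1 := Nat.floor_le h0
  have h2 := Nat.lt_floor_add_one (X - u)
  rw [if_pos (by linarith)]
  gcongr
  linarith

/-- The geometric series behind `tailConst`. -/
lemma tsum_slices {σ : ℝ} (hσ : 1 < σ) (u : ℝ) :
    ∑' k : ℕ, ENNReal.ofReal (Real.exp (1 / σ ^ 2 * (u + k + 1))) *
        ENNReal.ofReal (Real.exp (-(u + k))) =
      ENNReal.ofReal (tailConst σ * Real.exp (-((1 - 1 / σ ^ 2) * u))) := by
  have h := one_sub_one_div_sq_pos hσ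
  have hr : Real.exp (-(1 - 1 / σ ^ 2)) < 1 := by
    rw [Real.exp_lt_one_iff]
    linarith
  have h1 : ∀ k : ℕ, ENNReal.ofReal (Real.exp (1 / σ ^ 2 * (u + k + 1))) *
        ENNReal.ofReal (Real.exp (-(u + k))) =
      ENNReal.ofReal (Real.exp (1 / σ ^ 2) * Real.exp (-((1 - 1 / σ ^ 2) * u)) *
        Real.exp (-(1 - 1 / σ ^ 2)) ^ k) := by
    intro k
    rw [← ENNReal.ofReal_mul (Real.exp_pos _).le, ← Real.exp_nat_mul, ← Real.exp_add,
      ← Real.exp_add, ← Real.exp_add]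
    congr 2
    ring
  simp_rw [h1]
  rw [← ENNReal.ofReal_tsum_of_nonneg (fun k => by positivity)
    ((summable_geometric_of_lt_one (Real.exp_pos _).le hr).mul_left _), tsum_mul_left,
    tsum_geometric_of_lt_one (Real.exp_pos _).le hr]
  congr 1
  unfold tailConst
  rw [div_eq_mul_inv]
  ring

/-! ### Expected number of pulls -/

section Interaction

variable {Ω : Type*} [MeasurableSpace Ω] {μ : Measure Ω} [IsProbabilityMeasure μ] {K : ℕ}
  {σ : ℝ} {Q₀ : Fin K → ℝ} {P : Fin K → Measure ℝ} {x : ℕ → Ω → Fin K} {y : ℕ → Ω → ℝ}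

/-- An underestimated optimal arm inflates the posterior odds against it by a factor whose mean
after `n` pulls is exponentially small in `n`: the likelihood ratio `exp (S ^ 2 / (2 * n * σ ^ 2))`
grows more slowly than the sub-Gaussian tail of `S` decays, as `1 < σ`. -/
lemma IsMINTS.sum_exp_sq_le (hσ : 1 < σ) (hP : ∀ j, IsProbabilityMeasure (P j))
    (hsub : SubGaussianRewards P) (h : IsMINTS μ σ Q₀ P x y) (k : Fin K) {Δ : ℝ} (hΔ : 0 < Δ)
    (n T : ℕ) :
    ∑ t ∈ Finset.range T, ∫⁻ ω, (if x t ω = k ∧ pulls k (data x y t ω) = n then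
        (if centeredSum (armMean P k) k (data x y t ω) ≤ -(n * (Δ / 4)) then
          ENNReal.ofReal (Real.exp
            (centeredSum (armMean P k) k (data x y t ω) ^ 2 / (2 * n) / σ ^ 2)) else 0)
        else 0) ∂μ ≤
      ENNReal.ofReal (tailConst σ *
        Real.exp (-(n * ((1 - 1 / σ ^ 2) * (Δ ^ 2 / 32))))) := by
  rcases Nat.eq_zero_or_pos n with rfl | hn
  -- for `n = 0` the exponent is a division by zero, hence zero, and the integrand is at most one
  · refine le_trans (Finset.sum_le_sum fun t _ => lintegral_mono fun ω => ?_)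
      ((h.sum_pulls_eq_le_one hP hsub k 0 T).trans ?_)
    · dsimp only
      split_ifs <;> simp
    · simpa using one_le_tailConst hσ
  have hn' : (0 : ℝ) < n := by exact_mod_cast hn
  set u : ℝ := n * (Δ ^ 2 / 32)
  have hu : 0 ≤ u := by positivity
  -- with this choice `sum_tail_le` bounds the lower tail `u + m ≤ S ^ 2 / (2 * n)`
  let l : ℕ → ℝ := fun m => -√(2 * (u + m) / n)
  have hl : ∀ m : ℕ, l m ^ 2 * n = 2 * (u + m) := by
    intro m
    simp only [l, neg_sq]
    rw [Real.sq_sqrt (by positivity)]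
    field_simp
  let I : ℕ → ℕ → Ω → ℝ≥0∞ := fun m t ω => if x t ω = k ∧ pulls k (data x y t ω) = n then
    (if l m ^ 2 * n ≤ l m * centeredSum (armMean P k) k (data x y t ω) then 1 else 0) else 0
  have hI : ∀ m t, AEMeasurable (I m t) μ := fun m t =>
    h.aemeasurable_comp t (armMean P k) k
      (G := fun i N s => if i = k ∧ N = n then (if l m ^ 2 * n ≤ l m * s then 1 else 0) else 0)
      fun i N => Measurable.ite (MeasurableSet.const _) (Measurable.ite
        (measurableSet_le measurable_const (by fun_prop)) measurable_const measurable_const)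
        measurable_const
  have key : ∀ t ω, (if x t ω = k ∧ pulls k (data x y t ω) = n then
        (if centeredSum (armMean P k) k (data x y t ω) ≤ -(n * (Δ / 4)) then
          ENNReal.ofReal (Real.exp
            (centeredSum (armMean P k) k (data x y t ω) ^ 2 / (2 * n) / σ ^ 2)) else 0)
        else 0) ≤
      ∑' m : ℕ, ENNReal.ofReal (Real.exp (1 / σ ^ 2 * (u + m + 1))) * I m t ω := by
    intro t ω
    simp only [I]
    generalize centeredSum (armMean P k) k (data x y t ω) = S
    split_ifs with h1 h2
    · have hS0 : S ≤ 0 := h2.trans (neg_nonpos.2 (by positivity))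
      have hX : u ≤ S ^ 2 / (2 * n) := by
        rw [le_div_iff₀ (by positivity)]
        have : (n * (Δ / 4)) ^ 2 ≤ (-S) ^ 2 :=
          pow_le_pow_left₀ (by positivity) (by linarith) 2
        simp only [u]
        nlinarith
      rw [show S ^ 2 / (2 * n) / σ ^ 2 = 1 / σ ^ 2 * (S ^ 2 / (2 * n)) by ring]
      refine (ofReal_exp_le_tsum (by positivity) hX).trans (ENNReal.tsum_le_tsum fun m => ?_)
      split_ifs with h3 h4
      · simp
      · refine absurd ?_ h4
        rw [le_div_iff₀ (by positivity)] at h3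
        -- `l m` and `S` are nonpositive, so the claim is `|l m * n| ≤ |S|`, checked on squares
        have h5 : |l m * n| ≤ |S| := by
          rw [← sq_le_sq, mul_pow, sq (n : ℝ), ← mul_assoc, hl]
          linarith
        rw [abs_of_nonpos hS0, abs_of_nonpos
          (mul_nonpos_of_nonpos_of_nonneg (neg_nonpos.2 (Real.sqrt_nonneg _)) hn'.le)] at h5
        have h6 : l m ≤ 0 := neg_nonpos.2 (Real.sqrt_nonneg _)
        nlinarith
      · exact zero_le
      · exact zero_le
    · exact zero_le
    · exact zero_le
  calc _ ≤ ∑ t ∈ Finset.range T, ∑' m : ℕ,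
        ENNReal.ofReal (Real.exp (1 / σ ^ 2 * (u + m + 1))) * ∫⁻ ω, I m t ω ∂μ := by
        refine Finset.sum_le_sum fun t _ => (lintegral_mono (key t)).trans (le_of_eq ?_)
        rw [lintegral_tsum fun m => (hI m t).const_mul _]
        exact tsum_congr fun m => lintegral_const_mul' _ _ ENNReal.ofReal_ne_top
    _ = ∑' m : ℕ, ENNReal.ofReal (Real.exp (1 / σ ^ 2 * (u + m + 1))) *
        ∑ t ∈ Finset.range T, ∫⁻ ω, I m t ω ∂μ := by
        rw [← Summable.tsum_finsetSum fun _ _ => ENNReal.summable]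
        exact tsum_congr fun m => (Finset.mul_sum _ _ _).symm
    _ ≤ ∑' m : ℕ, ENNReal.ofReal (Real.exp (1 / σ ^ 2 * (u + m + 1))) *
        ENNReal.ofReal (Real.exp (-(u + m))) := by
        refine ENNReal.tsum_le_tsum fun m => mul_le_mul_right ?_ _
        refine (h.sum_tail_le hP hsub (l m) k n T).trans (le_of_eq ?_)
        congr 3
        linarith [hl m]
    _ = _ := by
        rw [tsum_slices hσ]
        congr 4
        simp only [u]
        ring

/-- The expected number of pulls of arm `j` in the first `T` rounds. -/
def expectedPulls (μ : Measure Ω) (x : ℕ → Ω → Fin K) (T : ℕ) (j : Fin K) : ℝ≥0∞ :=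
  ∑ t ∈ Finset.range T, ∫⁻ ω, (if x t ω = j then 1 else 0) ∂μ

lemma measurable_oddsBound (σ Δ : ℝ) (n : ℕ) : Measurable (oddsBound σ Δ n) := by
  unfold oddsBound
  exact measurable_const.add (Measurable.ite (measurableSet_le measurable_id measurable_const)
    (by fun_prop) measurable_const)

lemma measurable_oddsBound_comp {K t : ℕ} (σ Δ c : ℝ) (k : Fin K) :
    Measurable fun D : Dataset K t =>
      ENNReal.ofReal (oddsBound σ Δ (pulls k D) (centeredSum c k D)) := by
  have h1 : Measurable fun p : ℕ × ℝ => oddsBound σ Δ p.1 p.2 :=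
    measurable_from_prod_countable_right fun n => measurable_oddsBound σ Δ n
  have h2 : Measurable fun D : Dataset K t => (pulls k D, centeredSum c k D) :=
    (measurable_pulls k).prodMk (measurable_centeredSum c k)
  exact (h1.comp h2).ennreal_ofReal

/-- The contribution of the posterior odds against the optimal arm `k` over all rounds is bounded
uniformly in the horizon. -/
lemma IsMINTS.sum_oddsBound_le (hσ : 1 < σ) (hP : ∀ j, IsProbabilityMeasure (P j))
    (hsub : SubGaussianRewards P) (h : IsMINTS μ σ Q₀ P x y) (k : Fin K) {Δ : ℝ} (hΔ : 0 < Δ)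
    (T : ℕ) :
    ∑ t ∈ Finset.range T, ∫⁻ ω, (if x t ω = k then ENNReal.ofReal (oddsBound σ Δ
        (pulls k (data x y t ω)) (centeredSum (armMean P k) k (data x y t ω))) else 0) ∂μ ≤
      ENNReal.ofReal (1 + 1 / (Δ ^ 2 / (32 * σ ^ 2))) +
        ENNReal.ofReal (tailConst σ) *
          ENNReal.ofReal (1 + 1 / ((1 - 1 / σ ^ 2) * (Δ ^ 2 / 32))) := by
  have hq := one_sub_one_div_sq_pos hσ
  have hσ0 : 0 < σ := by linarith
  refine (h.sum_lintegral_le_sum_sum (armMean P k) k T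
    (f := fun n s => ENNReal.ofReal (oddsBound σ Δ n s))
    fun n => (measurable_oddsBound σ Δ n).ennreal_ofReal).trans ?_
  have hn : ∀ n : ℕ, ∑ t ∈ Finset.range T, ∫⁻ ω, (if x t ω = k ∧ pulls k (data x y t ω) = n then
      ENNReal.ofReal (oddsBound σ Δ n (centeredSum (armMean P k) k (data x y t ω))) else 0) ∂μ ≤
      ENNReal.ofReal (Real.exp (-(n * (Δ ^ 2 / (32 * σ ^ 2))))) +
        ENNReal.ofReal (tailConst σ) *
          ENNReal.ofReal (Real.exp (-(n * ((1 - 1 / σ ^ 2) * (Δ ^ 2 / 32))))) := by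
    intro n
    rw [← ENNReal.ofReal_mul (zero_le_one.trans (one_le_tailConst hσ))]
    refine le_trans (le_of_eq ?_) (add_le_add
      (mul_le_of_le_one_right zero_le (h.sum_pulls_eq_le_one hP hsub k n T))
      (h.sum_exp_sq_le hσ hP hsub k hΔ n T))
    rw [Finset.mul_sum, ← Finset.sum_add_distrib]
    refine Finset.sum_congr rfl fun t _ => ?_
    rw [← lintegral_const_mul' _ _ ENNReal.ofReal_ne_top, ← lintegral_add_left'
      (h.aemeasurable_comp t (armMean P k) k (G := fun i N s =>
        ENNReal.ofReal (Real.exp (-(n * (Δ ^ 2 / (32 * σ ^ 2))))) * if i = k ∧ N = n then 1 else 0)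
        fun i N => measurable_const)]
    refine lintegral_congr fun ω => ?_
    by_cases h1 : x t ω = k ∧ pulls k (data x y t ω) = n
    · simp only [h1, and_self, if_true, mul_one, oddsBound]
      rw [ENNReal.ofReal_add (Real.exp_pos _).le (by split_ifs <;> positivity)]
      split_ifs <;> simp
    · simp [h1]
  refine (Finset.sum_le_sum fun n _ => hn n).trans ?_
  rw [Finset.sum_add_distrib, ← Finset.mul_sum]
  gcongr
  · exact sum_ofReal_exp_neg_mul_le (by positivity) T
  · exact sum_ofReal_exp_neg_mul_le (by positivity) T

/-- A pull of the suboptimal arm `j` happens either among its first `L` pulls, or while `j` is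
overestimated, or with a posterior probability controlled by `posterior_le`. -/
lemma IsMINTS.lintegral_pull_le (hK : 0 < K) (hσ : 0 < σ)
    (h : IsMINTS μ σ (uniformPrior K) P x y) {j k : Fin K} {Δ : ℝ} (hΔ : 0 < Δ)
    (hk : armMean P k = armMean P j + Δ) (L t : ℕ) :
    ∫⁻ ω, (if x t ω = j then 1 else 0) ∂μ ≤
      ∫⁻ ω, (if x t ω = j then (if pulls j (data x y t ω) < L then 1 else 0) else 0) ∂μ +
      ∫⁻ ω, (if x t ω = j then (if (Δ / 4) ^ 2 * (pulls j (data x y t ω)) ≤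
        Δ / 4 * centeredSum (armMean P j) j (data x y t ω) then 1 else 0) else 0) ∂μ +
      (ENNReal.ofReal (Real.exp (-(L * (Δ ^ 2 / (32 * σ ^ 2))))) +
      ∫⁻ ω, (if x t ω = k then ENNReal.ofReal (oddsBound σ Δ
        (pulls k (data x y t ω)) (centeredSum (armMean P k) k (data x y t ω))) else 0) ∂μ) := by
  let f : Dataset K t → ℝ≥0∞ := fun D => if L ≤ pulls j D ∧
    centeredSum (armMean P j) j D ≤ pulls j D * (Δ / 4) then 1 else 0
  have hf : Measurable f := Measurable.ite
    ((measurableSet_le measurable_const (measurable_pulls j)).inter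
      (measurableSet_le (measurable_centeredSum _ j) ((measurable_natCast_pulls j).mul_const _)))
    measurable_const measurable_const
  let w : Dataset K t → ℝ≥0∞ := fun D => ENNReal.ofReal (oddsBound σ Δ
    (pulls k D) (centeredSum (armMean P k) k D))
  have hw : Measurable w := measurable_oddsBound_comp σ Δ (armMean P k) k
  have h3 : ∫⁻ ω, (if x t ω = j then f (data x y t ω) else 0) ∂μ ≤
      ENNReal.ofReal (Real.exp (-(L * (Δ ^ 2 / (32 * σ ^ 2))))) +
        ∫⁻ ω, (if x t ω = k then w (data x y t ω) else 0) ∂μ := by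
    rw [h.lintegral_arm hK hσ t j hf, h.lintegral_arm hK hσ t k hw]
    calc _ ≤ ∫⁻ ω, (ENNReal.ofReal (Real.exp (-(L * (Δ ^ 2 / (32 * σ ^ 2))))) +
          w (data x y t ω) *
            ENNReal.ofReal (posterior σ (uniformPrior K) (data x y t ω) k)) ∂μ := by
          refine lintegral_mono fun ω => ?_
          simp only [f]
          generalize data x y t ω = D
          split_ifs with h1
          · rw [one_mul, ← ENNReal.ofReal_mul (oddsBound_nonneg _ _ _ _),
              ← ENNReal.ofReal_add (Real.exp_pos _).le
                (mul_nonneg (oddsBound_nonneg _ _ _ _) (posterior_nonneg hK hσ D k))]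
            refine ENNReal.ofReal_le_ofReal ((posterior_le hK hσ k hΔ hk h1.2).trans ?_)
            rw [mul_comm (posterior _ _ _ _)]
            gcongr
            exact h1.1
          · simp
      _ = _ := by
          rw [lintegral_add_left measurable_const, lintegral_const, measure_univ, mul_one]
  refine le_trans ?_ (add_le_add_right h3 _)
  have hA : AEMeasurable (fun ω => if x t ω = j then
      (if pulls j (data x y t ω) < L then (1 : ℝ≥0∞) else 0) else 0) μ :=
    h.aemeasurable_comp t (armMean P j) j
      (G := fun i N _ => if i = j then (if N < L then 1 else 0) else 0) fun i N => measurable_const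
  have hB : AEMeasurable (fun ω => if x t ω = j then
      (if (Δ / 4) ^ 2 * (pulls j (data x y t ω)) ≤
        Δ / 4 * centeredSum (armMean P j) j (data x y t ω) then (1 : ℝ≥0∞) else 0) else 0) μ :=
    h.aemeasurable_comp t (armMean P j) j
      (G := fun i N s => if i = j then (if (Δ / 4) ^ 2 * N ≤ Δ / 4 * s then 1 else 0) else 0)
      fun i N => Measurable.ite (MeasurableSet.const _) (Measurable.ite
        (measurableSet_le measurable_const (by fun_prop)) measurable_const measurable_const)
        measurable_const
  rw [add_assoc, ← lintegral_add_left' hB, ← lintegral_add_left' hA]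
  refine lintegral_mono fun ω => ?_
  simp only [f]
  by_cases hx : x t ω = j
  · simp only [hx, if_true]
    by_cases h1 : pulls j (data x y t ω) < L
    · rw [if_pos h1]
      exact le_self_add
    by_cases h2 : (Δ / 4) ^ 2 * (pulls j (data x y t ω)) ≤
        Δ / 4 * centeredSum (armMean P j) j (data x y t ω)
    · rw [if_pos h2, add_left_comm]
      exact le_self_add
    · rw [← add_assoc, if_pos (c := _ ∧ _)]
      · exact le_add_self
      · refine ⟨not_lt.1 h1, le_of_mul_le_mul_left ?_ (by positivity : 0 < Δ / 4)⟩
        linarith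
  · simp [hx]

/-- The four terms account for the first `L` pulls of `j`, the overestimation of `j`, the exponential
term of `posterior_le`, and the posterior odds against `k`. -/
lemma IsMINTS.expectedPulls_le_add (hK : 0 < K) (hσ : 1 < σ)
    (hP : ∀ j, IsProbabilityMeasure (P j)) (hsub : SubGaussianRewards P)
    (h : IsMINTS μ σ (uniformPrior K) P x y) {j k : Fin K} {Δ : ℝ} (hΔ : 0 < Δ)
    (hk : armMean P k = armMean P j + Δ) (L T : ℕ) :
    expectedPulls μ x T j ≤ L + ENNReal.ofReal (1 + 1 / (Δ ^ 2 / 32)) +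
      (T * ENNReal.ofReal (Real.exp (-(L * (Δ ^ 2 / (32 * σ ^ 2))))) +
      (ENNReal.ofReal (1 + 1 / (Δ ^ 2 / (32 * σ ^ 2))) +
        ENNReal.ofReal (tailConst σ) *
          ENNReal.ofReal (1 + 1 / ((1 - 1 / σ ^ 2) * (Δ ^ 2 / 32))))) := by
  unfold expectedPulls
  refine (Finset.sum_le_sum fun t _ =>
    h.lintegral_pull_le hK (by linarith) hΔ hk L t).trans ?_
  rw [Finset.sum_add_distrib, Finset.sum_add_distrib, Finset.sum_add_distrib]
  refine add_le_add (add_le_add ?_ ?_) (add_le_add (by simp)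
    (h.sum_oddsBound_le hσ hP hsub k hΔ T))
  · refine (h.sum_lintegral_le_sum_sum (armMean P j) j T
      (f := fun n _ => if n < L then 1 else 0) fun n => measurable_const).trans ?_
    calc _ ≤ ∑ n ∈ Finset.range T, if n < L then (1 : ℝ≥0∞) else 0 := by
          refine Finset.sum_le_sum fun n _ => ?_
          split_ifs
          · exact h.sum_pulls_eq_le_one hP hsub j n T
          · simp
      _ ≤ L := by
          rw [Finset.sum_boole]
          norm_cast
          calc _ ≤ (Finset.range L).card := Finset.card_le_card fun n hn => by simp_all
            _ = L := Finset.card_range L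
  · refine (h.sum_lintegral_le_sum_sum (armMean P j) j T
      (f := fun n s => if (Δ / 4) ^ 2 * n ≤ Δ / 4 * s then 1 else 0) fun n => Measurable.ite
        (measurableSet_le measurable_const (by fun_prop)) measurable_const
        measurable_const).trans ?_
    refine le_trans (Finset.sum_le_sum fun n _ => ?_)
      (sum_ofReal_exp_neg_mul_le (by positivity) T)
    refine (h.sum_tail_le hP hsub (Δ / 4) j n T).trans (le_of_eq ?_)
    congr 4
    ring

end Interaction

/-! ### The regret bound -/

lemma gap_nonneg {K : ℕ} (P : Fin K → Measure ℝ) (j : Fin K) : 0 ≤ gap P j :=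
  sub_nonneg.2 (le_ciSup (Set.finite_range (armMean P)).bddAbove j)

lemma regret_eq_sum_gap {Ω : Type*} {K : ℕ} (P : Fin K → Measure ℝ) (x : ℕ → Ω → Fin K) (T : ℕ)
    (ω : Ω) : regret P x T ω = ∑ t ∈ Finset.range T, gap P (x t ω) := rfl

lemma exists_armMean_eq_add_gap {K : ℕ} (hK : 0 < K) (P : Fin K → Measure ℝ) (j : Fin K) :
    ∃ k, armMean P k = armMean P j + gap P j := by
  have : NeZero K := ⟨hK.ne'⟩
  obtain ⟨k, hk⟩ := exists_eq_ciSup_of_finite (f := armMean P)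
  exact ⟨k, by rw [hk, gap]; ring⟩

/-- The constant in the bound for the expected number of pulls of a suboptimal arm. -/
def pullsConst (σ : ℝ) : ℝ :=
  36 + 64 * σ ^ 2 + tailConst σ + 32 * tailConst σ / (1 - 1 / σ ^ 2)

lemma one_le_pullsConst {σ : ℝ} (hσ : 1 < σ) : 1 ≤ pullsConst σ := by
  have h1 := one_sub_one_div_sq_pos hσ
  have h2 := one_le_tailConst hσ
  have : 0 ≤ 32 * tailConst σ / (1 - 1 / σ ^ 2) := by positivity
  unfold pullsConst
  nlinarith [sq_nonneg σ]

section Interaction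

variable {Ω : Type*} [MeasurableSpace Ω] {μ : Measure Ω} [IsProbabilityMeasure μ] {K : ℕ}
  {σ : ℝ} {P : Fin K → Measure ℝ} {x : ℕ → Ω → Fin K} {y : ℕ → Ω → ℝ}

lemma IsMINTS.expectedPulls_le (hK : 0 < K) (hσ : 1 < σ)
    (hP : ∀ j, IsProbabilityMeasure (P j)) (hsub : SubGaussianRewards P)
    (h : IsMINTS μ σ (uniformPrior K) P x y) {j : Fin K} (hj : 0 < gap P j) (T : ℕ) :
    expectedPulls μ x T j ≤ ENNReal.ofReal (pullsConst σ *
      (1 + Real.log (max (T * gap P j ^ 2) (Real.exp 1)) / gap P j ^ 2)) := by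
  obtain ⟨k, hk⟩ := exists_armMean_eq_add_gap hK P j
  have hq := one_sub_one_div_sq_pos hσ
  have hC := one_le_tailConst hσ
  have hσ0 : 0 < σ := by linarith
  generalize gap P j = Δ at *
  set m := max (T * Δ ^ 2) (Real.exp 1)
  have hm0 : 0 < m := (Real.exp_pos 1).trans_le (le_max_right _ _)
  have hl : 1 ≤ Real.log m := by
    rw [Real.le_log_iff_exp_le hm0]
    exact le_max_right _ _
  -- after `L` pulls of arm `j` the exponential term of `posterior_le` is below `1 / (T * Δ ^ 2)`
  let L := ⌈32 * σ ^ 2 * Real.log m / Δ ^ 2⌉₊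
  have hL1 : 32 * σ ^ 2 * Real.log m / Δ ^ 2 ≤ L := Nat.le_ceil _
  have hL2 : (L : ℝ) ≤ 32 * σ ^ 2 * Real.log m / Δ ^ 2 + 1 :=
    (Nat.ceil_lt_add_one (by positivity)).le
  have hT : T * Real.exp (-(L * (Δ ^ 2 / (32 * σ ^ 2)))) ≤ 1 / Δ ^ 2 := by
    have h1 : Real.exp (-(L * (Δ ^ 2 / (32 * σ ^ 2)))) ≤ m⁻¹ := by
      rw [← Real.exp_log hm0, ← Real.exp_neg, Real.exp_le_exp]
      rw [div_le_iff₀ (by positivity)] at hL1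
      rw [neg_le_neg_iff, ← mul_div_assoc, le_div_iff₀ (by positivity)]
      linarith
    calc T * Real.exp (-(L * (Δ ^ 2 / (32 * σ ^ 2)))) ≤ T * m⁻¹ := by gcongr
      _ ≤ 1 / Δ ^ 2 := by
        rw [← div_eq_mul_inv, div_le_div_iff₀ hm0 (by positivity), one_mul]
        exact le_max_left _ _
  refine (h.expectedPulls_le_add hK hσ hP hsub hj hk L T).trans ?_
  rw [← ENNReal.ofReal_natCast L, ← ENNReal.ofReal_natCast T,
    ← ENNReal.ofReal_mul (by positivity), ← ENNReal.ofReal_mul (by positivity),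
    ← ENNReal.ofReal_add (by positivity) (by positivity),
    ← ENNReal.ofReal_add (by positivity) (by positivity),
    ← ENNReal.ofReal_add (by positivity) (by positivity),
    ← ENNReal.ofReal_add (by positivity) (by positivity)]
  refine ENNReal.ofReal_le_ofReal ?_
  rw [show 1 / (Δ ^ 2 / 32) = 32 * (1 / Δ ^ 2) by field_simp,
    show 1 / (Δ ^ 2 / (32 * σ ^ 2)) = 32 * σ ^ 2 * (1 / Δ ^ 2) by field_simp,
    show 1 / ((1 - 1 / σ ^ 2) * (Δ ^ 2 / 32)) = 32 / (1 - 1 / σ ^ 2) * (1 / Δ ^ 2) by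
      field_simp]
  rw [show 32 * σ ^ 2 * Real.log m / Δ ^ 2 = 32 * σ ^ 2 * (Real.log m / Δ ^ 2) by ring] at hL2
  have hle : 1 / Δ ^ 2 ≤ Real.log m / Δ ^ 2 := by gcongr
  unfold pullsConst
  rw [show 32 * tailConst σ / (1 - 1 / σ ^ 2) = tailConst σ * (32 / (1 - 1 / σ ^ 2)) by ring]
  have hr : 0 < 32 / (1 - 1 / σ ^ 2) := by positivity
  generalize 32 / (1 - 1 / σ ^ 2) = r at *
  generalize Real.log m / Δ ^ 2 = v at *
  have hv : 0 ≤ v := le_trans (by positivity) hle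
  generalize 1 / Δ ^ 2 = u at *
  generalize tailConst σ = C at *
  have e1 : 32 * σ ^ 2 * u ≤ 32 * σ ^ 2 * v := by gcongr
  have e2 : C * (r * u) ≤ C * (r * v) := by gcongr
  have e3 : 0 ≤ C * v := by positivity
  have e4 : 0 ≤ C * r := by positivity
  nlinarith [sq_nonneg σ]

/-- Arms with gap at most `δ` cost at most the largest such gap in every round; every other arm is
charged for its expected number of pulls. -/
lemma IsMINTS.lintegral_regret_le (h : IsMINTS μ σ (uniformPrior K) P x y) (T : ℕ) {δ : ℝ} :
    ∫⁻ ω, ENNReal.ofReal (regret P x T ω) ∂μ ≤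
      ∑ j with δ < gap P j, ENNReal.ofReal (gap P j) * expectedPulls μ x T j +
        T * ENNReal.ofReal (⨆ j : {j : Fin K // gap P j ≤ δ}, gap P j) := by
  set m := ⨆ j : {j : Fin K // gap P j ≤ δ}, gap P j
  have hx : ∀ t, AEMeasurable (x t) μ := fun t => (h.arm t).aemeasurable_snd
  have hind : ∀ t j, AEMeasurable (fun ω =>
      ENNReal.ofReal (gap P j) * if x t ω = j then (1 : ℝ≥0∞) else 0) μ := fun t j =>
    (measurable_of_countable fun i : Fin K =>
      ENNReal.ofReal (gap P j) * if i = j then (1 : ℝ≥0∞) else 0).comp_aemeasurable (hx t)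
  have hpt : ∀ t ω, ENNReal.ofReal (gap P (x t ω)) ≤
      ∑ j with δ < gap P j, ENNReal.ofReal (gap P j) * (if x t ω = j then 1 else 0) +
        ENNReal.ofReal m := by
    intro t ω
    rcases le_or_gt (gap P (x t ω)) δ with hle | hlt
    · refine le_add_of_nonneg_of_le zero_le (ENNReal.ofReal_le_ofReal ?_)
      exact le_ciSup (f := fun j : {j : Fin K // gap P j ≤ δ} => gap P j)
        (Set.finite_range _).bddAbove ⟨x t ω, hle⟩
    · refine le_add_of_le_of_nonneg ?_ zero_le
      refine le_trans (le_of_eq ?_) (Finset.single_le_sum (fun _ _ => zero_le)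
        (Finset.mem_filter.2 ⟨Finset.mem_univ (x t ω), hlt⟩))
      simp
  simp_rw [regret_eq_sum_gap, ENNReal.ofReal_sum_of_nonneg fun t _ => gap_nonneg P _]
  rw [lintegral_finsetSum' (f := fun t ω => ENNReal.ofReal (gap P (x t ω))) _ fun t _ =>
    (measurable_of_countable fun i : Fin K => ENNReal.ofReal (gap P i)).comp_aemeasurable (hx t)]
  refine (Finset.sum_le_sum fun t _ => lintegral_mono (hpt t)).trans (le_of_eq ?_)
  have hsplit : ∀ t, ∫⁻ ω, (∑ j with δ < gap P j,
        ENNReal.ofReal (gap P j) * (if x t ω = j then 1 else 0) + ENNReal.ofReal m) ∂μ =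
      ∑ j with δ < gap P j, ENNReal.ofReal (gap P j) *
        ∫⁻ ω, (if x t ω = j then 1 else 0) ∂μ + ENNReal.ofReal m := by
    intro t
    rw [lintegral_add_right _ measurable_const, lintegral_const, measure_univ, mul_one,
      lintegral_finsetSum' _ fun j _ => hind t j]
    congr 1
    exact Finset.sum_congr rfl fun j _ => lintegral_const_mul' _ _ ENNReal.ofReal_ne_top
  simp_rw [hsplit]
  rw [Finset.sum_add_distrib, Finset.sum_comm]
  simp [expectedPulls, Finset.mul_sum]

lemma IsMINTS.integral_regret_le (hK : 0 < K) (hσ : 1 < σ)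
    (hP : ∀ j, IsProbabilityMeasure (P j)) (hsub : SubGaussianRewards P)
    (h : IsMINTS μ σ (uniformPrior K) P x y) (T : ℕ) {δ : ℝ} (hδ : 0 ≤ δ) :
    ∫ ω, regret P x T ω ∂μ ≤ pullsConst σ * regretBound P T δ := by
  have hC := one_le_pullsConst hσ
  have hm : 0 ≤ ⨆ j : {j : Fin K // gap P j ≤ δ}, gap P j :=
    Real.iSup_nonneg fun j => gap_nonneg P j
  have hlog : ∀ j, 0 ≤ Real.log (max (T * gap P j ^ 2) (Real.exp 1)) := fun j =>
    Real.log_nonneg ((Real.one_le_exp zero_le_one).trans (le_max_right _ _))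
  have hterm : ∀ j, 0 ≤ Real.log (max (T * gap P j ^ 2) (Real.exp 1)) / gap P j + gap P j :=
    fun j => add_nonneg (div_nonneg (hlog j) (gap_nonneg P j)) (gap_nonneg P j)
  have hmeas : AEStronglyMeasurable (regret P x T) μ := by
    refine AEMeasurable.aestronglyMeasurable ?_
    change AEMeasurable (fun ω => ∑ t ∈ Finset.range T, gap P (x t ω)) μ
    exact Finset.aemeasurable_fun_sum _ fun t _ =>
      (measurable_of_countable (gap P)).comp_aemeasurable (h.arm t).aemeasurable_snd
  have hbound : 0 ≤ regretBound P T δ :=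
    add_nonneg (Finset.sum_nonneg fun j _ => hterm j) (mul_nonneg (Nat.cast_nonneg T) hm)
  have hnonneg : ∀ ω, 0 ≤ regret P x T ω := fun ω =>
    Finset.sum_nonneg fun t _ => gap_nonneg P (x t ω)
  rw [integral_eq_lintegral_of_nonneg_ae (Filter.Eventually.of_forall hnonneg) hmeas]
  refine ENNReal.toReal_le_of_le_ofReal (mul_nonneg (by linarith) hbound) ?_
  refine (h.lintegral_regret_le T (δ := δ)).trans ?_
  have hj : ∀ j ∈ ({j | δ < gap P j} : Finset (Fin K)),
      ENNReal.ofReal (gap P j) * expectedPulls μ x T j ≤ ENNReal.ofReal (pullsConst σ *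
        (Real.log (max (T * gap P j ^ 2) (Real.exp 1)) / gap P j + gap P j)) := by
    intro j hj
    have hpos : 0 < gap P j := hδ.trans_lt (Finset.mem_filter.1 hj).2
    refine (mul_le_mul_right (h.expectedPulls_le hK hσ hP hsub hpos T) _).trans (le_of_eq ?_)
    rw [← ENNReal.ofReal_mul hpos.le]
    congr 1
    field_simp
    ring
  refine (add_le_add_left (Finset.sum_le_sum hj) _).trans ?_
  rw [← ENNReal.ofReal_sum_of_nonneg fun j _ => mul_nonneg (by linarith) (hterm j),
    ← Finset.mul_sum, ← ENNReal.ofReal_natCast T, ← ENNReal.ofReal_mul (Nat.cast_nonneg T),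
    ← ENNReal.ofReal_add (mul_nonneg (by linarith) (Finset.sum_nonneg fun j _ => hterm j))
      (mul_nonneg (Nat.cast_nonneg T) hm)]
  refine ENNReal.ofReal_le_ofReal ?_
  unfold regretBound
  rw [mul_add]
  refine add_le_add (le_of_eq ?_) (le_mul_of_one_le_left (mul_nonneg (Nat.cast_nonneg T) hm) hC)
  congr!

end Interaction

end MINTS

end

theorem mainTheorem2 (σ : ℝ) (hσ : 1 < σ) :
    ∃ C : ℝ, 0 < C ∧
      ∀ (K : ℕ) (_ : 1 ≤ K) (P : Fin K → Measure ℝ) (_ : ∀ j, IsProbabilityMeasure (P j))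
        (_ : MINTS.SubGaussianRewards P)
        (Ω : Type*) (_ : MeasurableSpace Ω) (μ : Measure Ω) (_ : IsProbabilityMeasure μ)
        (x : ℕ → Ω → Fin K) (y : ℕ → Ω → ℝ)
        (_ : MINTS.IsMINTS μ σ (MINTS.uniformPrior K) P x y)
        (T : ℕ) (_ : 1 ≤ T),
        ∫ ω, MINTS.regret P x T ω ∂μ
          ≤ C * ⨅ δ : {δ : ℝ // 0 ≤ δ}, MINTS.regretBound P T δ := by
  have hC : 0 < MINTS.pullsConst σ := zero_lt_one.trans_le (MINTS.one_le_pullsConst hσ)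
  refine ⟨MINTS.pullsConst σ, hC, ?_⟩
  intro K hK P hP hsub Ω _ μ _ x y h T _
  have : Nonempty {δ : ℝ // 0 ≤ δ} := ⟨⟨0, le_rfl⟩⟩
  rw [← div_le_iff₀' hC]
  refine le_ciInf fun δ => ?_
  rw [div_le_iff₀' hC]
  exact h.integral_regret_le hK hσ hP hsub T δ.2
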